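/- A \emph{commutative residuated lattice} (CRL) is a lattice $M$ with a commutative monoid structure $(M,\cdot,1)$ whose multiplication is isotone, together with a binary operation $\backslash$ such that $b \le a\backslash c \iff a\cdot b \le c$ for all $a,b,c$. It is \emph{integral} if $a \le 1$ for all $a$, and \emph{cancellative} if $a\cdot x \le b\cdot x$ implies $a \le b$. Each Abelian $\ell$-group (Abelian group with a translation-invariant lattice order) is a CRL with $a\backslash c = a^{-1}c$. A poset is \emph{dually well-partially-ordered} (dually wpo) if it has no infinite ascending chains and no infinite antichains. A \emph{conucleus} on a CRL $M$ is a monotone map $\sigma\colon M\to M$ with $\sigma(\sigma(a))=\sigma(a)\le a$, $\sigma(a)\cdot\sigma(b)\le\sigma(a\cdot b)$ and $\sigma(1)=1$; its \emph{conuclear image} is the CRL $M_\sigma=\{a : \sigma(a)=a\}$ with the order, multiplication and unit inherited from $M$ (and with residual $\sigma(a\backslash c)$). The conuclear image is called \emph{negative} if $\sigma(a)\le 1$ for all $a\in M$. A \emph{nucleus} on a CRL $M$ is a monotone map $\gamma\colon M\to M$ with $a\le\gamma(a)=\gamma(\gamma(a))$ and $\gamma(a)\cdot\gamma(b)\le\gamma(a\cdot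 b)$; its \emph{nuclear image} is the CRL $M_\gamma=\{a:\gamma(a)=a\}$ with the order and residual inherited from $M$, multiplication $a\cdot_\gamma b=\gamma(a\cdot b)$ and unit $\gamma(1)$. A CRL $M$ satisfies the \emph{square condition} if for all $m \ge 0$, $n\ge 1$, all $x_1,\dots,x_m,y\in M$ and all functions $f\colon\{1,\dots,n\}\times\{1,\dots,m\}\to\{1,\dots,n\}$ the following holds: writing $\pi_{ij}=\prod_{k\,:\,f(i,k)=j}x_k$ (so that $\pi_{i1}\pi_{i2}\cdots\pi_{in}=x_1\cdots x_m$ for each $i$; empty products equal $1$), \[ \pi_{1j}\,\pi_{2j}\cdots\pi_{nj}\le y\ \text{ for all } j=1,\dots,n\quad\Longrightarrow\quad x_1x_2\cdots x_m\le y. \] \textbf{Theorem.} The following classes of commutative residuated lattices (considered up to isomorphism) coincide: \begin{enumerate} \item[(i)] dually wpo integral CRLs satisfying the square condition; \item[(ii)] dually wpo nuclear images of integral cancellative CRLs (that is, the CRLs which are dually wpo and isomorphic to $L_\gamma$ for some integral cancellative CRL $L$ and some nucleus $\gamma$ on $L$); \item[(iii)] dually wpo nuclear images of negative conuclear images of Abelian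 $\ell$-groups (that is, the CRLs which are dually wpo and isomorphic to $(G_\sigma)_\gamma$ for some Abelian $\ell$-group $G$, some conucleus $\sigma$ on $G$ with $\sigma(a)\le 1$ for all $a\in G$, and some nucleus $\gamma$ on $G_\sigma$). \end{enumerate} -/

import Mathlib

universe u

/-- Residuation for a commutative partially ordered monoid: multiplication is isotone and has a
residual `res a c`. By commutativity the two residuals `a \ c` and `c / a` are the same element.
A commutative residuated lattice is a type with `[CommMonoid M] [Lattice M] [CommResiduated M]`. -/
class CommResiduated (M : Type u) [CommMonoid M] [PartialOrder M] extends IsOrderedMonoid M where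
  /-- The residual `a \ c = c / a`. -/
  res : M → M → M
  le_res_iff : ∀ a b c : M, b ≤ res a c ↔ a * b ≤ c

/-- Abelian lattice-ordered groups are commutative residuated lattices, with `a \ c = a⁻¹ * c`. -/
instance CommResiduated.ofCommGroup (G : Type u) [CommGroup G] [PartialOrder G]
    [IsOrderedMonoid G] : CommResiduated G where
  res a c := a⁻¹ * c
  le_res_iff _ _ _ := le_inv_mul_iff_mul_le

/-- A pomonoid is integral if its unit is the top element. -/
def IntegralPomonoid (M : Type u) [CommMonoid M] [PartialOrder M] : Prop :=
  ∀ a : M, a ≤ 1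

/-- (Order) cancellativity of a commutative pomonoid. -/
def CancellativePomonoid (M : Type u) [CommMonoid M] [PartialOrder M] : Prop :=
  ∀ a b x : M, a * x ≤ b * x → a ≤ b

/-- Dual well-partial-orders: no infinite ascending chains and no infinite antichains. -/
def DuallyWPO (M : Type u) [PartialOrder M] : Prop :=
  WellFoundedGT M ∧ ∀ s : Set M, IsAntichain (· ≤ ·) s → s.Finite

/-- The square condition. The variables are `x k` for `k : Fin m`, and the `n × n` table (`n ≥ 1`)
is encoded by `f`: in row `i`, the variable `x k` is placed in column `f i k`. Hence the cell
`(i, j)` is the subproduct `∏ k with f i k = j, x k` (possibly empty), and each row is a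
decomposition of the product of all the variables. If the product of each column is below `y`,
then so is the product of all the variables. -/
def SquareCondition (M : Type u) [CommMonoid M] [PartialOrder M] : Prop :=
  ∀ (m n : ℕ), 1 ≤ n → ∀ (f : Fin n → Fin m → Fin n) (x : Fin m → M) (y : M),
    (∀ j : Fin n, ∏ i : Fin n, ∏ k : Fin m with f i k = j, x k ≤ y) → ∏ k : Fin m, x k ≤ y

/-- A conucleus on a pomonoid: an interior operator `σ` with `σ a * σ b ≤ σ (a * b)` and
`σ 1 = 1`. -/
structure PomonoidConucleus (M : Type u) [CommMonoid M] [PartialOrder M] where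
  /-- The underlying map. -/
  toFun : M → M
  monotone' : Monotone toFun
  le_self' : ∀ a, toFun a ≤ a
  idem' : ∀ a, toFun (toFun a) = toFun a
  mul_le' : ∀ a b, toFun a * toFun b ≤ toFun (a * b)
  map_one' : toFun 1 = 1

/-- A nucleus on a pomonoid: a closure operator `γ` with `γ a * γ b ≤ γ (a * b)`. -/
structure PomonoidNucleus (M : Type u) [CommMonoid M] [PartialOrder M] where
  /-- The underlying map. -/
  toFun : M → M
  monotone' : Monotone toFun
  self_le' : ∀ a, a ≤ toFun a
  idem' : ∀ a, toFun (toFun a) = toFun a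
  mul_le' : ∀ a b, toFun a * toFun b ≤ toFun (a * b)

namespace PomonoidConucleus

/-- A conucleus is negative if all its values are below the unit. -/
def IsNegative {M : Type u} [CommMonoid M] [PartialOrder M] (σ : PomonoidConucleus M) : Prop :=
  ∀ a : M, σ.toFun a ≤ 1

/-- The conuclear image: the open elements. -/
def Image {M : Type u} [CommMonoid M] [PartialOrder M] (σ : PomonoidConucleus M) : Type u :=
  {a : M // σ.toFun a = a}

instance {M : Type u} [CommMonoid M] [PartialOrder M] (σ : PomonoidConucleus M) :
    PartialOrder σ.Image :=
  inferInstanceAs (PartialOrder {a : M // σ.toFun a = a})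

/-- Multiplication and unit are inherited. -/
instance {M : Type u} [CommMonoid M] [PartialOrder M] [IsOrderedMonoid M]
    (σ : PomonoidConucleus M) : CommMonoid σ.Image where
  mul a b := ⟨a.1 * b.1, le_antisymm (σ.le_self' _) (by
    have h := σ.mul_le' a.1 b.1
    rwa [a.2, b.2] at h)⟩
  one := ⟨1, σ.map_one'⟩
  mul_assoc a b c := Subtype.ext (mul_assoc a.1 b.1 c.1)
  one_mul a := Subtype.ext (one_mul a.1)
  mul_one a := Subtype.ext (mul_one a.1)
  mul_comm a b := Subtype.ext (mul_comm a.1 b.1)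

/-- Joins are inherited, meets are `σ (a ⊓ b)`. -/
instance {M : Type u} [CommMonoid M] [Lattice M] (σ : PomonoidConucleus M) :
    Lattice σ.Image where
  sup a b := ⟨a.1 ⊔ b.1, le_antisymm (σ.le_self' _) (sup_le
    (a.2.symm.trans_le (σ.monotone' le_sup_left))
    (b.2.symm.trans_le (σ.monotone' le_sup_right)))⟩
  inf a b := ⟨σ.toFun (a.1 ⊓ b.1), σ.idem' _⟩
  le_sup_left a b := (le_sup_left : a.1 ≤ a.1 ⊔ b.1)
  le_sup_right a b := (le_sup_right : b.1 ≤ a.1 ⊔ b.1)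
  sup_le a b c h h' := (sup_le h h' : a.1 ⊔ b.1 ≤ c.1)
  inf_le_left a b := ((σ.le_self' _).trans inf_le_left : σ.toFun (a.1 ⊓ b.1) ≤ a.1)
  inf_le_right a b := ((σ.le_self' _).trans inf_le_right : σ.toFun (a.1 ⊓ b.1) ≤ b.1)
  le_inf a b c h h' :=
    (a.2.symm.trans_le (σ.monotone' (le_inf h h')) : a.1 ≤ σ.toFun (b.1 ⊓ c.1))

/-- Residuals are `σ (a \ c)`. -/
instance {M : Type u} [CommMonoid M] [PartialOrder M] [CommResiduated M]
    (σ : PomonoidConucleus M) : CommResiduated σ.Image where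
  mul_le_mul_left a b h c := (mul_le_mul_left (show a.1 ≤ b.1 from h) c.1 : a.1 * c.1 ≤ b.1 * c.1)
  res a c := ⟨σ.toFun (CommResiduated.res a.1 c.1), σ.idem' _⟩
  le_res_iff a b c :=
    (⟨fun h => (CommResiduated.le_res_iff a.1 b.1 c.1).1 (h.trans (σ.le_self' _)),
      fun h => b.2.symm.trans_le
        (σ.monotone' ((CommResiduated.le_res_iff a.1 b.1 c.1).2 h))⟩ :
      b.1 ≤ σ.toFun (CommResiduated.res a.1 c.1) ↔ a.1 * b.1 ≤ c.1)

end PomonoidConucleus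

namespace PomonoidNucleus

/-- The nuclear image: the closed elements. -/
def Image {M : Type u} [CommMonoid M] [PartialOrder M] (γ : PomonoidNucleus M) : Type u :=
  {a : M // γ.toFun a = a}

instance {M : Type u} [CommMonoid M] [PartialOrder M] (γ : PomonoidNucleus M) :
    PartialOrder γ.Image :=
  inferInstanceAs (PartialOrder {a : M // γ.toFun a = a})

theorem map_map_mul {M : Type u} [CommMonoid M] [PartialOrder M] [IsOrderedMonoid M]
    (γ : PomonoidNucleus M) (a b : M) : γ.toFun (γ.toFun a * b) = γ.toFun (a * b) := by
  apply le_antisymm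
  · calc γ.toFun (γ.toFun a * b) ≤ γ.toFun (γ.toFun a * γ.toFun b) :=
          γ.monotone' (mul_le_mul' le_rfl (γ.self_le' b))
      _ ≤ γ.toFun (γ.toFun (a * b)) := γ.monotone' (γ.mul_le' a b)
      _ = γ.toFun (a * b) := γ.idem' _
  · exact γ.monotone' (mul_le_mul' (γ.self_le' a) le_rfl)

/-- Multiplication is `γ (a * b)` and the unit is `γ 1`. -/
instance {M : Type u} [CommMonoid M] [PartialOrder M] [IsOrderedMonoid M]
    (γ : PomonoidNucleus M) : CommMonoid γ.Image where
  mul a b := ⟨γ.toFun (a.1 * b.1), γ.idem' _⟩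
  one := ⟨γ.toFun 1, γ.idem' _⟩
  mul_assoc a b c := Subtype.ext (by
    change γ.toFun (γ.toFun (a.1 * b.1) * c.1) = γ.toFun (a.1 * γ.toFun (b.1 * c.1))
    rw [map_map_mul, mul_comm a.1 (γ.toFun _), map_map_mul, mul_comm (b.1 * c.1), mul_assoc])
  one_mul a := Subtype.ext (by
    change γ.toFun (γ.toFun 1 * a.1) = a.1
    rw [map_map_mul, one_mul, a.2])
  mul_one a := Subtype.ext (by
    change γ.toFun (a.1 * γ.toFun 1) = a.1
    rw [mul_comm, map_map_mul, one_mul, a.2])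
  mul_comm a b := Subtype.ext (congrArg γ.toFun (mul_comm a.1 b.1))

/-- Meets are inherited, joins are `γ (a ⊔ b)`. -/
instance {M : Type u} [CommMonoid M] [Lattice M] (γ : PomonoidNucleus M) :
    Lattice γ.Image where
  sup a b := ⟨γ.toFun (a.1 ⊔ b.1), γ.idem' _⟩
  inf a b := ⟨a.1 ⊓ b.1, le_antisymm (le_inf
    ((γ.monotone' inf_le_left).trans_eq a.2)
    ((γ.monotone' inf_le_right).trans_eq b.2)) (γ.self_le' _)⟩
  le_sup_left a b := (le_sup_left.trans (γ.self_le' _) : a.1 ≤ γ.toFun (a.1 ⊔ b.1))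
  le_sup_right a b := (le_sup_right.trans (γ.self_le' _) : b.1 ≤ γ.toFun (a.1 ⊔ b.1))
  sup_le a b c h h' :=
    ((γ.monotone' (sup_le h h')).trans_eq c.2 : γ.toFun (a.1 ⊔ b.1) ≤ c.1)
  inf_le_left a b := (inf_le_left : a.1 ⊓ b.1 ≤ a.1)
  inf_le_right a b := (inf_le_right : a.1 ⊓ b.1 ≤ b.1)
  le_inf a b c h h' := (le_inf h h' : a.1 ≤ b.1 ⊓ c.1)

/-- Residuals are inherited. -/
instance {M : Type u} [CommMonoid M] [PartialOrder M] [CommResiduated M]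
    (γ : PomonoidNucleus M) : CommResiduated γ.Image where
  mul_le_mul_left a b h c :=
    (γ.monotone' (mul_le_mul_left (show a.1 ≤ b.1 from h) c.1) :
      γ.toFun (a.1 * c.1) ≤ γ.toFun (b.1 * c.1))
  res a c := ⟨CommResiduated.res a.1 c.1, le_antisymm (by
    rw [CommResiduated.le_res_iff]
    calc a.1 * γ.toFun (CommResiduated.res a.1 c.1)
        = γ.toFun a.1 * γ.toFun (CommResiduated.res a.1 c.1) := by rw [a.2]
      _ ≤ γ.toFun (a.1 * CommResiduated.res a.1 c.1) := γ.mul_le' _ _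
      _ ≤ γ.toFun c.1 := γ.monotone' ((CommResiduated.le_res_iff _ _ _).1 le_rfl)
      _ = c.1 := c.2) (γ.self_le' _)⟩
  le_res_iff a b c :=
    (⟨fun h => (γ.monotone' ((CommResiduated.le_res_iff a.1 b.1 c.1).1 h)).trans_eq c.2,
      fun h => (CommResiduated.le_res_iff a.1 b.1 c.1).2 ((γ.self_le' _).trans h)⟩ :
      b.1 ≤ CommResiduated.res a.1 c.1 ↔ γ.toFun (a.1 * b.1) ≤ c.1)

end PomonoidNucleus

/-- `M` is (isomorphic to) a nuclear image of the commutative residuated lattice `L`. An order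
isomorphism that preserves multiplication also preserves the unit, meets, joins and residuals, so
this is isomorphism of residuated lattices. -/
def IsNuclearImageOf (M : Type u) [CommMonoid M] [Lattice M] [CommResiduated M]
    (L : Type u) [CommMonoid L] [Lattice L] [CommResiduated L] : Prop :=
  ∃ γ : PomonoidNucleus L, Nonempty (M ≃*o γ.Image)

/-! From (ii) to (i): the columns of a square multiply to `(x_1⋯x_m)^n`, so if all are below `y`,
this power is below `y^n`, and in a cancellative residuated lattice powers reflect the order. The
square condition passes to nuclear images because `γ a ≤ y ↔ a ≤ y` for closed `y`. From (iii) to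
(ii), cancellation is inherited from the group.

From (i) to (iii): multisets over `M`, ordered by `MultisetDominates`, form a cancellative integral
monoid `F`, which the product maps onto `M`. The order of `F` is a cone in the group of functions `M
→ ℤ`. The linear quotients by all total extensions of this cone yield an `ℓ`-group `G` with a map `ι
: F → G`. A Zorn argument shows that `ι s` is below a finite join of `ι t` only if some `n • s`
dominates a sum of `n` of these `t`; the square condition then says exactly that `s.prod` is below
every upper bound of the `t.prod`.

By Higman's lemma every nonempty set in `F` has a finite cofinal subset, so all nonempty joins of
values of `ι` exist in `G`. Let `σ a` be the join of the `ι s ≤ a`. The product map extends along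
joins to a multiplicative surjection `p` from the conuclear image to `M`, with a right adjoint `q`,
and `q ∘ p` is the nucleus. -/

/-! ### Total cones and the lattice-ordered group -/

/-- A commutative group with a submonoid `P` that contains `h` or `h⁻¹` for each `h` has a
homomorphism to a linearly ordered group such that `P` is the preimage of the positive cone. -/
theorem exists_hom_linearOrder {H : Type u} [CommGroup H] (P : Submonoid H)
    (hP : ∀ h, h ∈ P ∨ h⁻¹ ∈ P) :
    ∃ (Q : Type u) (_ : CommGroup Q) (_ : LinearOrder Q) (_ : IsOrderedMonoid Q) (π : H →* Q),
      ∀ h, 1 ≤ π h ↔ h ∈ P := by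
  classical
  let N : Subgroup H :=
    { carrier := {h | h ∈ P ∧ h⁻¹ ∈ P}
      mul_mem' := fun {a b} ha hb => ⟨P.mul_mem ha.1 hb.1, by
        rw [mul_inv]; exact P.mul_mem ha.2 hb.2⟩
      one_mem' := ⟨P.one_mem, by rw [inv_one]; exact P.one_mem⟩
      inv_mem' := fun {a} ha => ⟨ha.2, by rw [inv_inv]; exact ha.1⟩ }
  -- `P` is a union of cosets of `N = P ∩ P⁻¹`, so nothing is lost in the quotient.
  have key : ∀ h, QuotientGroup.mk' N h ∈ P.map (QuotientGroup.mk' N) ↔ h ∈ P := by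
    intro h
    refine ⟨?_, fun hh => ⟨h, hh, rfl⟩⟩
    rintro ⟨p, hp, hph⟩
    have h1 : p⁻¹ * h ∈ N := QuotientGroup.eq.1 hph
    have := P.mul_mem hp h1.1
    rwa [mul_inv_cancel_left] at this
  let C : GroupCone (H ⧸ N) :=
    { P.map (QuotientGroup.mk' N) with
      eq_one_of_mem_of_inv_mem' := by
        intro a
        obtain ⟨a, rfl⟩ := QuotientGroup.mk'_surjective N a
        intro h1 h2
        rw [← map_inv] at h2
        exact (QuotientGroup.eq_one_iff a).2 ⟨(key _).1 h1, (key _).1 h2⟩ }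
  have : HasMemOrInvMem C := ⟨fun a => by
    obtain ⟨a, rfl⟩ := QuotientGroup.mk'_surjective N a
    rw [← map_inv]
    exact (hP a).imp (key a).2 (key _).2⟩
  let o : LinearOrder (H ⧸ N) := LinearOrder.mkOfGroupCone C
  refine ⟨H ⧸ N, inferInstance, o, IsOrderedMonoid.mkOfCone C, QuotientGroup.mk' N, fun h => ?_⟩
  change QuotientGroup.mk' N h / 1 ∈ P.map (QuotientGroup.mk' N) ↔ _
  rw [div_one, key]

/-- A submonoid of a commutative group that is disjoint from a subsemigroup `S` extends to a
submonoid which is disjoint from `S` and contains `h` or `h⁻¹` for each `h`. -/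
theorem exists_total_submonoid_disjoint {H : Type u} [CommGroup H] (P₀ : Submonoid H)
    (S : Subsemigroup H) (hS : ∀ h ∈ P₀, h ∉ S) :
    ∃ P : Submonoid H, P₀ ≤ P ∧ (∀ h, h ∈ P ∨ h⁻¹ ∈ P) ∧ ∀ h ∈ P, h ∉ S := by
  obtain ⟨P, hle, hmax⟩ := zorn_le_nonempty₀ {P : Submonoid H | ∀ h ∈ P, h ∉ S} (by
    intro c hc hchain P hPc
    refine ⟨sSup c, ?_, fun _ => le_sSup⟩
    intro h hh
    rw [Submonoid.mem_sSup_of_directedOn ⟨P, hPc⟩ hchain.directedOn] at hh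
    obtain ⟨Q, hQ, hhQ⟩ := hh
    exact hc hQ h hhQ) P₀ hS
  have pow_mem : ∀ a ∈ S, ∀ n : ℕ, a ^ (n + 1) ∈ S := by
    intro a ha n
    induction n with
    | zero => simpa using ha
    | succ n ih => rw [pow_succ]; exact S.mul_mem ih ha
  -- By maximality, adjoining `h` to `P` meets `S`. The exponent is positive since `P` itself misses
  -- `S`.
  have ext : ∀ h, h ∉ P → ∃ p ∈ P, ∃ n : ℕ, p * h ^ (n + 1) ∈ S := by
    intro h hh
    have h1 : ¬ (∀ x ∈ P ⊔ Submonoid.powers h, x ∉ S) := fun h1 =>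
      hh (hmax.2 h1 le_sup_left
        ((le_sup_right : _ ≤ P ⊔ Submonoid.powers h) (Submonoid.mem_powers h)))
    push Not at h1
    obtain ⟨x, hx, hxS⟩ := h1
    obtain ⟨p, hp, q, ⟨n, rfl⟩, rfl⟩ := Submonoid.mem_sup.1 hx
    rcases n with _ | n
    · exact absurd hxS (by simpa using hmax.1 p hp)
    · exact ⟨p, hp, n, hxS⟩
  refine ⟨P, hle, fun h => ?_, hmax.1⟩
  by_contra hcon
  push Not at hcon
  obtain ⟨p, hp, n, hn⟩ := ext h hcon.1
  obtain ⟨q, hq, m, hm⟩ := ext h⁻¹ hcon.2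
  -- These powers make the exponents of `h` and `h⁻¹` cancel, giving an element of both `P` and `S`.
  refine hmax.1 (p ^ (m + 1) * q ^ (n + 1)) (P.mul_mem (P.pow_mem hp _) (P.pow_mem hq _)) ?_
  have h2 := S.mul_mem (pow_mem _ hn m) (pow_mem _ hm n)
  have e : (p * h ^ (n + 1)) ^ (m + 1) * (q * h⁻¹ ^ (m + 1)) ^ (n + 1) =
      p ^ (m + 1) * q ^ (n + 1) := by
    rw [mul_pow, mul_pow, ← pow_mul, ← pow_mul, mul_comm (m + 1) (n + 1), mul_mul_mul_comm,
      ← mul_pow h, mul_inv_cancel, one_pow, mul_one]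
  rwa [e] at h2

/-- The convex subgroup generated by a multiplicatively closed family of elements below `1`. -/
theorem exists_cofinal_convex_subgroup {F : Type u} [AddCommMonoid F] {G : Type u} [CommGroup G]
    [Lattice G] [IsOrderedMonoid G] (ι : F → G) (hadd : ∀ s t, ι (s + t) = ι s * ι t)
    (hneg : ∀ s, ι s ≤ 1) :
    ∃ (K : Type u) (_ : CommGroup K) (_ : Lattice K) (_ : IsOrderedMonoid K) (j : K → G)
      (κ : F → K), (∀ a b, j a ≤ j b ↔ a ≤ b) ∧ (∀ a b, j (a ⊔ b) = j a ⊔ j b) ∧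
      (∀ s, j (κ s) = ι s) ∧ (∀ s t, κ (s + t) = κ s * κ t) ∧ ∀ a, ∃ s, κ s ≤ a := by
  have hl : ∀ s t, ι (s + t) ≤ ι s := fun s t => by
    rw [hadd]; exact mul_le_of_le_one_right' (hneg t)
  have hr : ∀ s t, ι (s + t) ≤ ι t := fun s t => by rw [add_comm]; exact hl t s
  have h0 : ι 0 = 1 := by simpa using hadd 0 0
  let K : Subgroup G :=
    { carrier := {a | ∃ s, ι s ≤ a ∧ a ≤ (ι s)⁻¹}
      mul_mem' := by
        rintro a b ⟨s, hs, hs'⟩ ⟨t, ht, ht'⟩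
        refine ⟨s + t, ?_, ?_⟩
        · rw [hadd]; exact mul_le_mul' hs ht
        · rw [hadd, mul_inv]; exact mul_le_mul' hs' ht'
      one_mem' := ⟨0, by rw [h0], by rw [h0, inv_one]⟩
      inv_mem' := by
        rintro a ⟨s, hs, hs'⟩
        exact ⟨s, le_inv_of_le_inv hs', inv_le_inv' hs⟩ }
  have hsup : ∀ ⦃a b : G⦄, a ∈ K → b ∈ K → a ⊔ b ∈ K := by
    rintro a b ⟨s, hs, hs'⟩ ⟨t, ht, ht'⟩
    exact ⟨s + t, (hl s t).trans (hs.trans le_sup_left),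
      sup_le (hs'.trans (inv_le_inv' (hl s t))) (ht'.trans (inv_le_inv' (hr s t)))⟩
  have hinf : ∀ ⦃a b : G⦄, a ∈ K → b ∈ K → a ⊓ b ∈ K := by
    rintro a b ⟨s, hs, hs'⟩ ⟨t, ht, ht'⟩
    exact ⟨s + t, le_inf ((hl s t).trans hs) ((hr s t).trans ht),
      inf_le_left.trans (hs'.trans (inv_le_inv' (hl s t)))⟩
  let : Lattice K := Subtype.lattice hsup hinf
  refine ⟨K, inferInstance, inferInstance, { mul_le_mul_left := fun a b h c => ?_ },
    Subtype.val,
    fun s => ⟨ι s, s, le_rfl, (hneg s).trans (one_le_inv'.2 (hneg s))⟩, fun _ _ => Iff.rfl,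
    fun _ _ => rfl, fun _ => rfl, fun s t => Subtype.ext (hadd s t), ?_⟩
  · exact (mul_le_mul_left (show a.1 ≤ b.1 from h) c.1 : a.1 * c.1 ≤ b.1 * c.1)
  · rintro ⟨a, s, hs, hs'⟩
    exact ⟨s, hs⟩

/-- An integral cancellative relation on a commutative monoid embeds into a lattice-ordered group
where `ι s` is below a finite join of elements `ι t` only if a multiple of `s` is related to
a sum of that number of elements `t`. -/
theorem exists_latticeOrderedGroup_embedding {F : Type u} [AddCommMonoid F] {H : Type u}
    [CommGroup H] (e : F → H) (eadd : ∀ s t, e (s + t) = e s * e t)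
    (einj : Function.Injective e) (r : F → F → Prop) (rrefl : ∀ s, r s s)
    (radd : ∀ s t s' t', r s t → r s' t' → r (s + s') (t + t'))
    (rcancel : ∀ s t x, r (s + x) (t + x) → r s t) (rzero : ∀ s, r s 0) :
    ∃ (G : Type u) (_ : CommGroup G) (_ : Lattice G) (_ : IsOrderedMonoid G) (ι : F → G),
      (∀ s t, ι (s + t) = ι s * ι t) ∧ (∀ s t, r s t → ι s ≤ ι t) ∧ (∀ s, ι s ≤ 1) ∧
      (∀ a, ∃ s, ι s ≤ a) ∧
      ∀ (s : F) (T : Finset F) (hT : T.Nonempty), ι s ≤ T.sup' hT ι →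
        ∃ l : List F, l ≠ [] ∧ (∀ t ∈ l, t ∈ T) ∧ r (l.length • s) l.sum := by
  have e0 : e 0 = 1 := by simpa using eadd 0 0
  let P₀ : Submonoid H :=
    { carrier := {h | ∃ s t, r s t ∧ h = e t / e s}
      mul_mem' := by
        rintro _ _ ⟨s, t, h, rfl⟩ ⟨s', t', h', rfl⟩
        exact ⟨s + s', t + t', radd _ _ _ _ h h', by rw [eadd, eadd, mul_div_mul_comm]⟩
      one_mem' := ⟨0, 0, rrefl 0, by simp⟩ }
  -- A quotient can have several representations; cancellativity of `r` makes the choice irrelevant.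
  have hP₀ : ∀ s t, e t / e s ∈ P₀ ↔ r s t := by
    intro s t
    refine ⟨?_, fun h => ⟨s, t, h, rfl⟩⟩
    rintro ⟨s', t', h, heq⟩
    rw [div_eq_div_iff_mul_eq_mul, ← eadd, ← eadd] at heq
    have h1 := radd _ _ _ _ h (rrefl s)
    rw [← einj heq, add_comm s' s] at h1
    exact rcancel _ _ _ h1
  let I := {P : Submonoid H // P₀ ≤ P ∧ ∀ h, h ∈ P ∨ h⁻¹ ∈ P}
  choose Q i1 i2 i3 π hπ using fun P : I => exists_hom_linearOrder P.1 P.2.2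
  have hπle : ∀ (P : I) s t, π P (e s) ≤ π P (e t) ↔ e t / e s ∈ P.1 := by
    intro P s t
    rw [← hπ, map_div, one_le_div']
  let ι₀ : F → ∀ P : I, Q P := fun s P => π P (e s)
  have hι₀ : ∀ s t, r s t → ι₀ s ≤ ι₀ t := fun s t h P =>
    (hπle P s t).2 (P.2.1 ((hP₀ s t).2 h))
  have hneg : ∀ s, ι₀ s ≤ 1 := by
    intro s
    have : ι₀ 0 = 1 := by funext P; simp [ι₀, e0]
    exact this ▸ hι₀ s 0 (rzero s)
  -- In the full product an element need not lie above any `ι₀ s`; the convex subgroup ensures this.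
  obtain ⟨G, j1, j2, j3, j, ι, hj, hjsup, hjι, hadd, hcof⟩ :=
    exists_cofinal_convex_subgroup ι₀ (fun s t => by funext P; simp [ι₀, eadd]) hneg
  refine ⟨G, j1, j2, j3, ι, hadd, fun s t h => ?_, fun s => ?_, hcof, fun s T hT h => ?_⟩
  · rw [← hj, hjι, hjι]; exact hι₀ s t h
  · have h0 : ι 0 = 1 := by simpa using hadd 0 0
    rw [← h0, ← hj, hjι, hjι]; exact hι₀ s 0 (rzero s)
  · by_contra hcon
    push Not at hcon
    -- The subsemigroup generated by the `e t / e s` with `t ∈ T`. A total cone missing it places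
    -- every `e t` strictly below `e s`, so in that coordinate `s` is not below the join.
    let S : Subsemigroup H :=
      { carrier := {h | ∃ l : List F, l ≠ [] ∧ (∀ t ∈ l, t ∈ T) ∧
          h = e l.sum / e (l.length • s)}
        mul_mem' := by
          rintro _ _ ⟨l, hl, hlT, rfl⟩ ⟨l', hl', hlT', rfl⟩
          refine ⟨l ++ l', by simp [hl], ?_, ?_⟩
          · intro t ht
            rcases List.mem_append.1 ht with ht | ht
            exacts [hlT t ht, hlT' t ht]
          · rw [List.sum_append, List.length_append, add_smul, eadd, eadd, mul_div_mul_comm] }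
    obtain ⟨P, hP, htot, hPS⟩ := exists_total_submonoid_disjoint P₀ S (by
      rintro h hh ⟨l, hl, hlT, rfl⟩
      exact hcon l hl hlT ((hP₀ _ _).1 hh))
    have h1 : ι₀ s ≤ T.sup' hT ι₀ := by
      have e1 : j (T.sup' hT ι) = T.sup' hT ι₀ := by
        rw [Finset.apply_sup'_eq_sup'_comp hT j hjsup]
        exact Finset.sup'_congr hT rfl fun t _ => hjι t
      rw [← hjι, ← e1]
      exact (hj _ _).2 h
    have h2 := h1 ⟨P, hP, htot⟩
    rw [Finset.sup'_apply, Finset.le_sup'_iff] at h2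
    obtain ⟨t, ht, hle⟩ := h2
    refine hPS _ ((hπle _ _ _).1 hle) ⟨[t], by simp, by simpa using ht, by simp⟩

/-! ### Multiset domination, Higman's lemma and the square condition -/

/-- The multiset `t` can be matched injectively with elements of `s` below its own. -/
def MultisetDominates {M : Type u} [Preorder M] (s t : Multiset M) : Prop :=
  ∃ s' ≤ s, Multiset.Rel (· ≤ ·) s' t

namespace MultisetDominates

variable {M : Type u}

theorem refl [Preorder M] (s : Multiset M) : MultisetDominates s s :=
  ⟨s, le_rfl, Multiset.rel_refl_of_refl_on fun _ _ => le_rfl⟩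

theorem zero_right [Preorder M] (s : Multiset M) : MultisetDominates s 0 :=
  ⟨0, Multiset.zero_le _, Multiset.Rel.zero⟩

theorem add [Preorder M] {s t s' t' : Multiset M} (h : MultisetDominates s t)
    (h' : MultisetDominates s' t') : MultisetDominates (s + s') (t + t') := by
  obtain ⟨a, ha, hr⟩ := h
  obtain ⟨b, hb, hr'⟩ := h'
  exact ⟨a + b, add_le_add ha hb, hr.add hr'⟩

/-- If `a` is matched to the removed `x` on the right, and `x` on the left is matched to `b`, then
`a ≤ x ≤ b` lets `a` be rematched to `b`. -/
theorem cancel_cons [Preorder M] {s t : Multiset M} {x : M}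
    (h : MultisetDominates (x ::ₘ s) (x ::ₘ t)) : MultisetDominates s t := by
  classical
  obtain ⟨s', hs', hr⟩ := h
  obtain ⟨a, s₁, hax, hr₁, rfl⟩ := Multiset.rel_cons_right.1 hr
  by_cases hx : x ∈ s₁
  · obtain ⟨s₂, rfl⟩ := Multiset.exists_cons_of_mem hx
    obtain ⟨b, t', hxb, hr₂, rfl⟩ := Multiset.rel_cons_left.1 hr₁
    refine ⟨a ::ₘ s₂, ?_, Multiset.Rel.cons (hax.trans hxb) hr₂⟩
    rw [Multiset.cons_swap] at hs'
    exact (Multiset.cons_le_cons_iff x).1 hs'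
  · refine ⟨s₁, ?_, hr₁⟩
    exact (Multiset.le_cons_of_notMem hx).1 ((Multiset.le_cons_self _ _).trans hs')

theorem cancel [Preorder M] {s t x : Multiset M}
    (h : MultisetDominates (s + x) (t + x)) : MultisetDominates s t := by
  induction x using Multiset.induction_on with
  | empty => simpa using h
  | cons a x ih =>
    rw [Multiset.add_cons, Multiset.add_cons] at h
    exact ih h.cancel_cons

theorem prod_le_of_rel [CommMonoid M] [PartialOrder M] [IsOrderedMonoid M] {s t : Multiset M}
    (h : Multiset.Rel (· ≤ ·) s t) : s.prod ≤ t.prod := by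
  induction h with
  | zero => exact le_rfl
  | cons hab _ ih => rw [Multiset.prod_cons, Multiset.prod_cons]; exact mul_le_mul' hab ih

theorem prod_le_one [CommMonoid M] [PartialOrder M] [IsOrderedMonoid M]
    (hM : IntegralPomonoid M) (s : Multiset M) : s.prod ≤ 1 := by
  induction s using Multiset.induction_on with
  | empty => simp
  | cons a s ih => rw [Multiset.prod_cons]; exact mul_le_one' (hM a) ih

theorem prod_le [CommMonoid M] [PartialOrder M] [IsOrderedMonoid M]
    (hM : IntegralPomonoid M) {s t : Multiset M} (h : MultisetDominates s t) :
    s.prod ≤ t.prod := by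
  obtain ⟨s', hs', hr⟩ := h
  obtain ⟨u, rfl⟩ := Multiset.le_iff_exists_add.1 hs'
  rw [Multiset.prod_add]
  exact (mul_le_of_le_one_right' (prod_le_one hM u)).trans (prod_le_of_rel hr)

/-- Higman's lemma for multisets. -/
theorem exists_lt [PartialOrder M] (hM : DuallyWPO M) (u : ℕ → Multiset M) :
    ∃ m n, m < n ∧ MultisetDominates (u n) (u m) := by
  have hwqo : WellQuasiOrdered (fun a b : M => b ≤ a) := by
    have : WellQuasiOrderedLE Mᵒᵈ := by
      refine wellQuasiOrderedLE_iff.2 ⟨?_, fun s hs => ?_⟩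
      · have := hM.1
        infer_instance
      · exact hM.2 (OrderDual.toDual ⁻¹' s) fun a ha b hb hab h =>
          hs hb ha (fun e => hab e.symm) h
    exact this.wqo
  have : IsPreorder M (fun a b => b ≤ a) :=
    { refl := fun _ => le_rfl, trans := fun _ _ _ h h' => h'.trans h }
  -- Higman's lemma for lists under the reversed order; a sublist embedding gives a matching of
  -- multisets.
  have hH := Set.PartiallyWellOrderedOn.partiallyWellOrderedOn_sublistForall₂
    (fun a b : M => b ≤ a) (s := Set.univ) (fun f => hwqo fun n => (f n).1)
  obtain ⟨m, n, hmn, h⟩ := hH fun n => ⟨(u n).toList, fun _ _ => trivial⟩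
  refine ⟨m, n, hmn, ?_⟩
  obtain ⟨l, hl, hsub⟩ := List.sublistForall₂_iff.1 h
  refine ⟨(l : Multiset M), ?_, ?_⟩
  · rw [← Multiset.coe_toList (u n)]
    exact Multiset.coe_le.2 hsub.subperm
  · rw [← Multiset.coe_toList (u m)]
    change List.Forall₂ _ (u m).toList l at hl
    clear h hsub
    generalize (u m).toList = l' at hl
    induction hl with
    | nil => exact Multiset.Rel.zero
    | cons hab _ ih => exact Multiset.Rel.cons hab ih

/-- A nonempty set of multisets has a finite cofinal subset. -/
theorem exists_finset_cofinal [PartialOrder M] (hM : DuallyWPO M) {U : Set (Multiset M)}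
    (hU : U.Nonempty) : ∃ T : Finset (Multiset M), T.Nonempty ∧ (∀ t ∈ T, t ∈ U) ∧
      ∀ s ∈ U, ∃ t ∈ T, MultisetDominates s t := by
  by_contra hcon
  push Not at hcon
  obtain ⟨u, hu, hlt⟩ := exists_seq_of_forall_finset_exists (fun s => s ∈ U)
    (fun t s => ¬ MultisetDominates s t) (by
      intro T hT
      rcases T.eq_empty_or_nonempty with rfl | hne
      · exact ⟨hU.choose, hU.choose_spec, by simp⟩
      · exact hcon T hne hT)
  obtain ⟨m, n, hmn, h⟩ := exists_lt hM u
  exact hlt m n hmn h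

/-- Lifts a splitting of a multiset of values to a colouring of the indices, which supplies the
table `f` of the square condition. -/
theorem exists_fiber_eq {I J : Type*} [DecidableEq I] [DecidableEq J] (x : I → M)
    (A : Finset I) (B : Finset J) (w : J → Multiset M) (j₀ : J)
    (h : A.val.map x = ∑ j ∈ B, w j) :
    ∃ f : I → J, ∀ j ∈ B, (A.filter fun i => f i = j).val.map x = w j := by
  induction A using Finset.induction_on generalizing w with
  | empty =>
    refine ⟨fun _ => j₀, fun j hj => ?_⟩
    have : w j ≤ 0 := by
      have h1 := Finset.single_le_sum (f := w) (fun _ _ => Multiset.zero_le _) hj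
      rw [← h] at h1
      simpa using h1
    simpa using (Multiset.le_zero.1 this).symm
  | insert a A ha ih =>
    rw [Finset.insert_val_of_notMem ha, Multiset.map_cons] at h
    have hmem : x a ∈ ∑ j ∈ B, w j := h ▸ Multiset.mem_cons_self _ _
    obtain ⟨j₁, hj₁, hmem⟩ := Multiset.mem_sum.1 hmem
    obtain ⟨v, hv⟩ := Multiset.exists_cons_of_mem hmem
    have hsum : ∑ j ∈ B, w j = x a ::ₘ ∑ j ∈ B, Function.update w j₁ v j := by
      rw [← Finset.add_sum_erase B w hj₁, ← Finset.add_sum_erase B _ hj₁, hv,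
        Function.update_self, Multiset.cons_add]
      congr 2
      exact Finset.sum_congr rfl fun j hj => by
        rw [Function.update_of_ne (Finset.ne_of_mem_erase hj)]
    obtain ⟨f, hf⟩ := ih (Function.update w j₁ v) ((Multiset.cons_inj_right _).1 (h.trans hsum))
    refine ⟨Function.update f a j₁, fun j hj => ?_⟩
    have hA : A.filter (fun i => Function.update f a j₁ i = j) = A.filter fun i => f i = j :=
      Finset.filter_congr fun i hi => by
        rw [Function.update_of_ne (ne_of_mem_of_not_mem hi ha)]
    rw [Finset.filter_insert, Function.update_self, hA]
    have hfj := hf j hj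
    by_cases hjj : j₁ = j
    · subst hjj
      rw [if_pos rfl, Finset.insert_val_of_notMem (by simp [ha]), Multiset.map_cons, hfj,
        Function.update_self, hv]
    · rw [if_neg hjj, hfj, Function.update_of_ne (Ne.symm hjj)]

theorem exists_rel_sum [Preorder M] {J : Type*} [DecidableEq J] (B : Finset J)
    (t : J → Multiset M) (s : Multiset M) (h : Multiset.Rel (· ≤ ·) s (∑ j ∈ B, t j)) :
    ∃ w : J → Multiset M, s = ∑ j ∈ B, w j ∧ ∀ j ∈ B, Multiset.Rel (· ≤ ·) (w j) (t j) := by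
  induction B using Finset.induction_on generalizing s with
  | empty => exact ⟨fun _ => 0, by simpa using h, by simp⟩
  | insert a B ha ih =>
    rw [Finset.sum_insert ha] at h
    obtain ⟨s₀, s₁, h₀, h₁, rfl⟩ := Multiset.rel_add_right.1 h
    obtain ⟨w, rfl, hw⟩ := ih s₁ h₁
    refine ⟨Function.update w a s₀, ?_, fun j hj => ?_⟩
    · rw [Finset.sum_insert ha, Function.update_self]
      congr 1
      exact Finset.sum_congr rfl fun j hj => by
        rw [Function.update_of_ne (ne_of_mem_of_not_mem hj ha)]
    · rcases Finset.mem_insert.1 hj with rfl | hj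
      · rwa [Function.update_self]
      · rw [Function.update_of_ne (ne_of_mem_of_not_mem hj ha)]; exact hw j hj

/-- The square condition, in terms of multisets. -/
theorem prod_le_of_square [CommMonoid M] [PartialOrder M] [IsOrderedMonoid M]
    (hM : IntegralPomonoid M) (hsq : SquareCondition M) {s : Multiset M}
    {l : List (Multiset M)} (hl : l ≠ []) {y : M} (hy : ∀ t ∈ l, t.prod ≤ y)
    (h : MultisetDominates (l.length • s) l.sum) : s.prod ≤ y := by
  classical
  have hn : 1 ≤ l.length := List.length_pos_iff.2 hl
  let x : Fin s.toList.length → M := s.toList.get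
  have hx : Finset.univ.val.map x = s := by
    rw [Fin.univ_val_map, List.ofFn_get, Multiset.coe_toList]
  have hxp : (Finset.univ.val.map fun p : Fin l.length × Fin s.toList.length => x p.2) =
      l.length • s := by
    have : (Finset.univ.val.map fun p : Fin l.length × Fin s.toList.length => x p.2) =
        ∑ p : Fin l.length × Fin s.toList.length, {x p.2} := by
      rw [Finset.sum, ← Multiset.sum_map_singleton (Multiset.map _ _), Multiset.map_map]; rfl
    rw [this, Fintype.sum_prod_type]
    have : ∑ k, ({x k} : Multiset M) = s := by
      conv_rhs => rw [← hx, ← Multiset.sum_map_singleton (Multiset.map _ _), Multiset.map_map]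
      rfl
    simp [this]
  let t : Fin l.length → Multiset M := l.get
  have ht : l.sum = ∑ j, t j := by
    rw [← List.sum_ofFn]; simp [t]
  obtain ⟨s', hs', hr⟩ := h
  obtain ⟨v, hv⟩ := Multiset.le_iff_exists_add.1 hs'
  rw [ht] at hr
  obtain ⟨w, rfl, hw⟩ := exists_rel_sum _ _ _ hr
  let j₀ : Fin l.length := ⟨0, hn⟩
  -- The `n` copies of `s` are the rows, and `w j` is the part matched to the `j`-th member of `l`.
  -- The unmatched rest `v` goes into column `j₀`, where integrality makes it harmless.
  obtain ⟨f, hf⟩ := exists_fiber_eq (fun p : Fin l.length × Fin s.toList.length => x p.2)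
    Finset.univ Finset.univ (Function.update w j₀ (w j₀ + v)) j₀ (by
      rw [hxp, hv, ← Finset.add_sum_erase _ w (Finset.mem_univ j₀),
        ← Finset.add_sum_erase _ (Function.update _ _ _) (Finset.mem_univ j₀),
        Function.update_self, add_right_comm]
      congr 1
      exact Finset.sum_congr rfl fun j hj => by
        rw [Function.update_of_ne (Finset.ne_of_mem_erase hj)])
  have hprod : ∏ k, x k = s.prod := by
    conv_rhs => rw [← hx]
    rfl
  rw [← hprod]
  refine hsq _ _ hn (fun i k => f (i, k)) x y fun j => ?_
  have h1 : ∏ i, ∏ k with f (i, k) = j, x k = (Function.update w j₀ (w j₀ + v) j).prod := by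
    rw [← hf j (Finset.mem_univ j)]
    change _ = ∏ p with f p = j, x p.2
    rw [Finset.prod_filter, Fintype.prod_prod_type]
    exact Finset.prod_congr rfl fun i _ => Finset.prod_filter _ _
  rw [h1]
  have h2 : (Function.update w j₀ (w j₀ + v) j).prod ≤ (w j).prod := by
    by_cases hj : j = j₀
    · subst hj
      rw [Function.update_self, Multiset.prod_add]
      exact mul_le_of_le_one_right' (prod_le_one hM v)
    · rw [Function.update_of_ne hj]
  exact h2.trans ((prod_le_of_rel (hw j (Finset.mem_univ j))).trans (hy _ (List.get_mem l j)))

end MultisetDominates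

/-! ### Cancellation and the square condition in nuclear images -/

theorem PomonoidConucleus.IsNegative.integralPomonoid_image {G : Type u} [CommGroup G]
    [PartialOrder G] [IsOrderedMonoid G] {σ : PomonoidConucleus G} (hσ : σ.IsNegative) :
    IntegralPomonoid σ.Image :=
  fun a => (a.2.symm.trans_le (hσ a.1) : a.1 ≤ 1)

theorem PomonoidConucleus.cancellativePomonoid_image {G : Type u} [CommGroup G]
    [PartialOrder G] [IsOrderedMonoid G] (σ : PomonoidConucleus G) :
    CancellativePomonoid σ.Image :=
  fun a b x h => (le_of_mul_le_mul_right' (show a.1 * x.1 ≤ b.1 * x.1 from h) : a.1 ≤ b.1)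

theorem IntegralPomonoid.of_isNuclearImageOf {M L : Type u} [CommMonoid M] [Lattice M]
    [CommResiduated M] [CommMonoid L] [Lattice L] [CommResiduated L] (hL : IntegralPomonoid L)
    (h : IsNuclearImageOf M L) : IntegralPomonoid M := by
  obtain ⟨γ, ⟨e⟩⟩ := h
  intro a
  rw [← map_le_map_iff e, map_one]
  exact ((hL (e a).1).trans (γ.self_le' 1) : (e a).1 ≤ γ.toFun 1)

namespace CommResiduated

variable {M : Type u} [CommMonoid M] [Lattice M] [CommResiduated M]

theorem mul_sup_le {a b c d : M} (h : a * b ≤ d) (h' : a * c ≤ d) : a * (b ⊔ c) ≤ d :=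
  (le_res_iff _ _ _).1 (sup_le ((le_res_iff _ _ _).2 h) ((le_res_iff _ _ _).2 h'))

theorem mul_le_of_isLUB {a b c : M} {A : Set M} (hA : IsLUB A a) (h : ∀ x ∈ A, x * b ≤ c) :
    a * b ≤ c := by
  rw [mul_comm, ← le_res_iff]
  exact hA.2 fun x hx => (le_res_iff _ _ _).2 (by rw [mul_comm]; exact h x hx)

theorem mul_le_of_isLUB_of_isLUB {a b c : M} {A B : Set M} (hA : IsLUB A a) (hB : IsLUB B b)
    (h : ∀ x ∈ A, ∀ y ∈ B, x * y ≤ c) : a * b ≤ c :=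
  mul_le_of_isLUB hA fun x hx => by
    rw [mul_comm]
    exact mul_le_of_isLUB hB fun y hy => by rw [mul_comm]; exact h x hx y hy

/-- Expanding the power, every monomial except `a ^ (n + 1)` has a factor `b`. -/
theorem sup_pow_succ_le (a b : M) (n : ℕ) :
    (a ⊔ b) ^ (n + 1) ≤ b * (a ⊔ b) ^ n ⊔ a ^ (n + 1) := by
  induction n with
  | zero => simp
  | succ n ih =>
    rw [pow_succ _ (n + 1)]
    refine mul_sup_le ?_ ?_
    · rw [mul_comm]
      refine (mul_le_mul' le_rfl ih).trans (mul_sup_le ?_ ?_)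
      · refine le_trans ?_ le_sup_left
        rw [pow_succ' _ n, mul_left_comm]
        exact mul_le_mul' le_rfl (mul_le_mul' le_sup_left le_rfl)
      · rw [← pow_succ']
        exact le_sup_right
    · rw [mul_comm]
      exact le_sup_left

/-- In a cancellative residuated lattice, positive powers reflect the order. -/
theorem le_of_pow_le_pow (hM : CancellativePomonoid M) {a b : M} {n : ℕ} (hn : 1 ≤ n)
    (h : a ^ n ≤ b ^ n) : a ≤ b := by
  obtain ⟨n, rfl⟩ := Nat.exists_eq_add_of_le' hn
  refine hM a b ((a ⊔ b) ^ n) ?_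
  calc a * (a ⊔ b) ^ n ≤ (a ⊔ b) ^ (n + 1) := by
        rw [pow_succ']; exact mul_le_mul' le_sup_left le_rfl
    _ ≤ b * (a ⊔ b) ^ n ⊔ a ^ (n + 1) := sup_pow_succ_le a b n
    _ ≤ b * (a ⊔ b) ^ n := sup_le le_rfl (h.trans (by
        rw [pow_succ']
        exact mul_le_mul' le_rfl (pow_le_pow_left' le_sup_right n)))

end CommResiduated

theorem CancellativePomonoid.squareCondition {L : Type u} [CommMonoid L] [Lattice L]
    [CommResiduated L] (hL : CancellativePomonoid L) : SquareCondition L := by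
  intro m n hn f x y h
  refine CommResiduated.le_of_pow_le_pow hL hn ?_
  have h1 : ∏ j, ∏ i, ∏ k with f i k = j, x k = (∏ k, x k) ^ n := by
    rw [Finset.prod_comm]
    have : ∀ i, ∏ j, ∏ k with f i k = j, x k = ∏ k, x k := fun i =>
      Finset.prod_fiberwise _ _ _
    simp [this]
  rw [← h1]
  refine (Finset.prod_le_prod' fun j _ => h j).trans ?_
  simp

namespace PomonoidNucleus

theorem map_le_coe_iff {L : Type u} [CommMonoid L] [PartialOrder L]
    (γ : PomonoidNucleus L) (a : L) (y : γ.Image) :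
    γ.toFun a ≤ y.1 ↔ a ≤ y.1 :=
  ⟨(γ.self_le' a).trans, fun h => (γ.monotone' h).trans_eq y.2⟩

theorem coe_prod_image {L : Type u} [CommMonoid L] [PartialOrder L] [IsOrderedMonoid L]
    (γ : PomonoidNucleus L) {I : Type*} (s : Finset I) (x : I → γ.Image) :
    (∏ i ∈ s, x i).1 = γ.toFun (∏ i ∈ s, (x i).1) := by
  classical
  induction s using Finset.induction_on with
  | empty => simp only [Finset.prod_empty]; rfl
  | insert a s ha ih =>
    rw [Finset.prod_insert ha, Finset.prod_insert ha]
    change γ.toFun ((x a).1 * (∏ i ∈ s, x i).1) = _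
    rw [ih, mul_comm, map_map_mul, mul_comm]

end PomonoidNucleus

/-- Below a closed `y`, outer applications of `γ` can be dropped; those inside the cells only
enlarge the column products. -/
theorem SquareCondition.of_isNuclearImageOf {M L : Type u} [CommMonoid M] [Lattice M]
    [CommResiduated M] [CommMonoid L] [Lattice L] [CommResiduated L] (hL : SquareCondition L)
    (h : IsNuclearImageOf M L) : SquareCondition M := by
  obtain ⟨γ, ⟨e⟩⟩ := h
  intro m n hn f x y hxy
  rw [← map_le_map_iff e, map_prod]
  change (∏ k, e (x k)).1 ≤ (e y).1
  rw [γ.coe_prod_image, γ.map_le_coe_iff]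
  refine hL m n hn f (fun k => (e (x k)).1) (e y).1 fun j => ?_
  have h1 := (map_le_map_iff e).2 (hxy j)
  simp only [map_prod] at h1
  change (∏ i, ∏ k with f i k = j, e (x k)).1 ≤ (e y).1 at h1
  rw [γ.coe_prod_image, γ.map_le_coe_iff] at h1
  refine le_trans (Finset.prod_le_prod' fun i _ => ?_) h1
  rw [γ.coe_prod_image]
  exact γ.self_le' _

/-! ### Presenting `M` as a nuclear image -/

/-- A surjective multiplicative map with a right adjoint exhibits a nuclear image. -/
theorem isNuclearImageOf_of_galoisConnection {M L : Type u} [CommMonoid M] [Lattice M]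
    [CommResiduated M] [CommMonoid L] [Lattice L] [CommResiduated L] {p : L → M} {q : M → L}
    (hpq : GaloisConnection p q) (hp : ∀ y, p (q y) = y) (hmul : ∀ a b, p (a * b) = p a * p b) :
    IsNuclearImageOf M L := by
  let γ : PomonoidNucleus L :=
    { toFun := fun a => q (p a)
      monotone' := fun a b h => hpq.monotone_u (hpq.monotone_l h)
      self_le' := hpq.le_u_l
      idem' := fun a => by rw [hp]
      mul_le' := fun a b => by rw [← hpq.le_iff_le, hmul, hp, hp, hmul] }
  refine ⟨γ, ⟨⟨⟨⟨fun y => ⟨q y, by change q (p (q y)) = q y; rw [hp]⟩, fun a => p a.1, hp,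
    fun a => Subtype.ext a.2⟩, fun a b => Subtype.ext ?_⟩, ?_⟩⟩⟩
  · change q (a * b) = q (p (q a * q b))
    rw [hmul, hp, hp]
  · intro a b
    change q a ≤ q b ↔ a ≤ b
    rw [← hpq.le_iff_le, hp]

/-- The ordered group generated by multisets presents `M` as a nuclear image. -/
theorem exists_negative_conucleus_isNuclearImageOf {M : Type u} [CommMonoid M] [Lattice M]
    [CommResiduated M] (hwpo : DuallyWPO M) (hint : IntegralPomonoid M)
    (hsq : SquareCondition M) :
    ∃ (G : Type u) (_ : CommGroup G) (_ : Lattice G) (_ : IsOrderedMonoid G)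
      (σ : PomonoidConucleus G), σ.IsNegative ∧ IsNuclearImageOf M σ.Image := by
  classical
  obtain ⟨G, i1, i2, i3, ι, hadd, hmono, hneg, hcof, hle⟩ :=
    exists_latticeOrderedGroup_embedding
      (fun (s : Multiset M) (a : M) => Multiplicative.ofAdd (s.count a : ℤ))
      (fun s t => by funext a; simp [← ofAdd_add])
      (fun s t h => by
        ext a
        have := congrFun h a
        simpa using this)
      MultisetDominates MultisetDominates.refl (fun _ _ _ _ h h' => h.add h')
      (fun _ _ _ h => h.cancel) MultisetDominates.zero_right
  have h0 : ι 0 = 1 := by simpa using hadd 0 0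
  -- One finite cofinal `T` computes the join both in `G` and in `M`, as `ι` and the product are
  -- both monotone for domination.
  have hlub : ∀ U : Set (Multiset M), U.Nonempty → ∃ T : Finset (Multiset M), ∃ hT : T.Nonempty,
      (∀ t ∈ T, t ∈ U) ∧ IsLUB (ι '' U) (T.sup' hT ι) ∧
      IsLUB (Multiset.prod '' U) (T.sup' hT Multiset.prod) := by
    intro U hU
    obtain ⟨T, hT, hTU, hc⟩ := MultisetDominates.exists_finset_cofinal hwpo hU
    refine ⟨T, hT, hTU, ⟨?_, ?_⟩, ⟨?_, ?_⟩⟩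
    · rintro _ ⟨s, hs, rfl⟩
      obtain ⟨t, ht, hst⟩ := hc s hs
      exact (hmono s t hst).trans (Finset.le_sup' ι ht)
    · exact fun b hb => Finset.sup'_le _ _ fun t ht => hb ⟨t, hTU t ht, rfl⟩
    · rintro _ ⟨s, hs, rfl⟩
      obtain ⟨t, ht, hst⟩ := hc s hs
      exact (hst.prod_le hint).trans (Finset.le_sup' Multiset.prod ht)
    · exact fun b hb => Finset.sup'_le _ _ fun t ht => hb ⟨t, hTU t ht, rfl⟩
  -- The only use of the square condition: it makes the extension of the product to joins
  -- consistent.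
  have key : ∀ (U : Set (Multiset M)) (g : G) (s : Multiset M) (y : M), U.Nonempty →
      IsLUB (ι '' U) g → ι s ≤ g → (∀ t ∈ U, t.prod ≤ y) → s.prod ≤ y := by
    intro U g s y hU hg hs hy
    obtain ⟨T, hT, hTU, hl, -⟩ := hlub U hU
    rw [hg.unique hl] at hs
    obtain ⟨l, hl0, hlT, hdom⟩ := hle s T hT hs
    exact MultisetDominates.prod_le_of_square hint hsq hl0 (fun t ht => hy t (hTU t (hlT t ht)))
      hdom
  have exG : ∀ U : Set (Multiset M), U.Nonempty → ∃ g, IsLUB (ι '' U) g := fun U hU =>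
    let ⟨_, _, _, h, _⟩ := hlub U hU; ⟨_, h⟩
  have exM : ∀ U : Set (Multiset M), U.Nonempty → ∃ y, IsLUB (Multiset.prod '' U) y :=
    fun U hU => let ⟨_, _, _, _, h⟩ := hlub U hU; ⟨_, h⟩
  choose σ hσ using fun a => exG {s | ι s ≤ a} (hcof a)
  have neY : ∀ y : M, {s : Multiset M | s.prod ≤ y}.Nonempty := fun y => ⟨{y}, by simp⟩
  choose p hp using fun a => exM {s | ι s ≤ a} (hcof a)
  choose q hq using fun y => exG {s | s.prod ≤ y} (neY y)
  have σle : ∀ a, σ a ≤ a := fun a => (hσ a).2 (by rintro _ ⟨s, hs, rfl⟩; exact hs)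
  have leσ : ∀ a s, ι s ≤ a → ι s ≤ σ a := fun a s hs => (hσ a).1 ⟨s, hs, rfl⟩
  have σmono : Monotone σ := fun a b h => (hσ a).2 (by
    rintro _ ⟨s, hs, rfl⟩; exact leσ b s (le_trans hs h))
  have σlub : ∀ (U : Set (Multiset M)) g, IsLUB (ι '' U) g → σ g = g := fun U g hg =>
    le_antisymm (σle g) (hg.2 (by
      rintro _ ⟨s, hs, rfl⟩; exact leσ g s (hg.1 ⟨s, hs, rfl⟩)))
  let S : PomonoidConucleus G :=
    { toFun := σ
      monotone' := σmono
      le_self' := σle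
      idem' := fun a => σlub _ _ (hσ a)
      mul_le' := fun a b => by
        refine CommResiduated.mul_le_of_isLUB_of_isLUB (hσ a) (hσ b) ?_
        rintro _ ⟨s, hs, rfl⟩ _ ⟨t, ht, rfl⟩
        rw [← hadd]
        exact leσ _ _ (by rw [hadd]; exact mul_le_mul' hs ht)
      map_one' := le_antisymm (σle 1) (h0 ▸ leσ (ι 0) 0 le_rfl) }
  refine ⟨G, i1, i2, i3, S, fun a => (hσ a).2 ?_, ?_⟩
  · rintro _ ⟨s, -, rfl⟩
    exact hneg s
  have hpq : ∀ (a : S.Image) y, p a.1 ≤ y ↔ a.1 ≤ q y := by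
    intro a y
    constructor
    · intro h
      rw [← show σ a.1 = a.1 from a.2]
      refine (hσ a.1).2 ?_
      rintro _ ⟨s, hs, rfl⟩
      exact (hq y).1 ⟨s, ((hp a.1).1 ⟨s, hs, rfl⟩).trans h, rfl⟩
    · intro h
      refine (hp a.1).2 ?_
      rintro _ ⟨s, hs, rfl⟩
      exact key _ _ s y (neY y) (hq y) (le_trans hs h) fun t ht => ht
  refine isNuclearImageOf_of_galoisConnection (p := fun a : S.Image => p a.1)
    (q := fun y => ⟨q y, σlub _ _ (hq y)⟩) hpq (fun y => le_antisymm ?_ ?_) fun a b =>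
    le_antisymm ?_ ?_
  · exact (hpq ⟨q y, σlub _ _ (hq y)⟩ y).2 le_rfl
  · have h1 : ι {y} ≤ q y := (hq y).1 ⟨{y}, by simp, rfl⟩
    simpa using (hp (q y)).1 ⟨{y}, h1, rfl⟩
  · refine (hp (a.1 * b.1)).2 ?_
    rintro _ ⟨s, hs, rfl⟩
    -- Open elements are joins of values of `ι` and multiplication distributes over joins, so `key`
    -- applies to `a * b` with sums `t + t'`.
    have hab : IsLUB (ι '' {u | ∃ t t', ι t ≤ a.1 ∧ ι t' ≤ b.1 ∧ t + t' = u}) (a.1 * b.1) := by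
      constructor
      · rintro _ ⟨_, ⟨t, t', ht, ht', rfl⟩, rfl⟩
        rw [hadd]
        exact mul_le_mul' ht ht'
      · intro c hc
        rw [← show σ a.1 = a.1 from a.2, ← show σ b.1 = b.1 from b.2]
        refine CommResiduated.mul_le_of_isLUB_of_isLUB (hσ a.1) (hσ b.1) ?_
        rintro _ ⟨t, ht, rfl⟩ _ ⟨t', ht', rfl⟩
        rw [← hadd]
        exact hc ⟨_, ⟨t, t', ht, ht', rfl⟩, rfl⟩
    refine key _ _ s _ ?_ hab hs ?_
    · obtain ⟨t, ht⟩ := hcof a.1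
      obtain ⟨t', ht'⟩ := hcof b.1
      exact ⟨_, t, t', ht, ht', rfl⟩
    · rintro _ ⟨t, t', ht, ht', rfl⟩
      rw [Multiset.prod_add]
      exact mul_le_mul' ((hp a.1).1 ⟨t, ht, rfl⟩) ((hp b.1).1 ⟨t', ht', rfl⟩)
  · refine CommResiduated.mul_le_of_isLUB_of_isLUB (hp a.1) (hp b.1) ?_
    rintro _ ⟨t, ht, rfl⟩ _ ⟨t', ht', rfl⟩
    rw [← Multiset.prod_add]
    exact (hp (a.1 * b.1)).1
      ⟨t + t', (by rw [hadd]; exact mul_le_mul' ht ht' : ι (t + t') ≤ _), rfl⟩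

theorem mainTheorem7 (M : Type u) [CommMonoid M] [Lattice M] [CommResiduated M] :
    List.TFAE [
      DuallyWPO M ∧ IntegralPomonoid M ∧ SquareCondition M,
      DuallyWPO M ∧
        ∃ (L : Type u) (_ : CommMonoid L) (_ : Lattice L) (_ : CommResiduated L),
          IntegralPomonoid L ∧ CancellativePomonoid L ∧ IsNuclearImageOf M L,
      DuallyWPO M ∧
        ∃ (G : Type u) (_ : CommGroup G) (_ : Lattice G) (_ : IsOrderedMonoid G)
          (σ : PomonoidConucleus G), σ.IsNegative ∧ IsNuclearImageOf M σ.Image] := by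
  tfae_have 1 → 3 := fun ⟨h, hint, hsq⟩ =>
    ⟨h, exists_negative_conucleus_isNuclearImageOf h hint hsq⟩
  tfae_have 3 → 2 := fun ⟨h, G, _, _, _, σ, hσ, himg⟩ =>
    ⟨h, σ.Image, inferInstance, inferInstance, inferInstance, hσ.integralPomonoid_image,
      σ.cancellativePomonoid_image, himg⟩
  tfae_have 2 → 1 := fun ⟨h, _, _, _, _, hint, hc, himg⟩ =>
    ⟨h, hint.of_isNuclearImageOf himg, hc.squareCondition.of_isNuclearImageOf himg⟩
  tfae_finish
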